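/- **Theorem 4 (Limitation on partial self correction in local subsystem codes).** Let qubits reside at the sites of a $D$-dimensional hypercubic lattice of linear size $L\ge 1$, with open or periodic boundary conditions, $D\ge 2$. Let $P$ be the group of Pauli operators on these qubits modulo phases, regarded as a vector space over $\mathbb F_2$; for a subgroup $K\le P$ let $K^\perp$ denote the subgroup of Pauli operators commuting with all elements of $K$. A subsystem code is given by its gauge group $G\le P$; its stabilizer group is $S=G\cap G^\perp$, its dressed logical operators are the elements of $S^\perp$, and its distance $d$ is the minimum weight (number of qubits acted on nontrivially) of an element of $S^\perp\setminus G$ ($d=\infty$ if $S^\perp=G$). Assume that $G$ is generated by operators each supported in a hypercube of linear size $w$, and let $\{S_a\}$ be a finite, possibly overcomplete, family of generators of $S$, each supported in a hypercube of linear size $w_S$, such that at most $m$ of the $S_a$ act nontrivially on any given qubit. For $x\in P$ let $E(x)$ be the number of $a$ such that $S_a$ anticommutes with $x$; this is the energy of $x|\psi\rangle$ for the Hamiltonian $H=-\sum_a\frac12(S_a-I)$ when $|\psi\rangle$ is a zero-energy state. Let $$\Delta(z)=\min_{\gamma}\max_{x\in\gamma}E(x),$$ where the minimum is over all finite walks $\gamma=(x_0,x_1,\dots,x_t)$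 in $P$ with $x_0=I$ and $x_t=z$ such that each $x_{i+1}x_i^{-1}$ has weight one, and let $$\Delta_{\max}=\max_{x\in S^\perp}\ \min_{y\in G}\ \Delta(xy).$$ 1. Let $D=2$. For all $w,w_S,m$ and all $c>0$ there is a constant $C$, independent of $L$ and of the code, such that $d\ge cL$ implies $\Delta_{\max}\le C$. That is, if $d=\Omega(L)$ then $\Delta_{\max}=O(1)$. 2. More generally, for all $D\ge2$, all $w,w_S,m$, all real $\alpha$ and all $c>0$ there is a constant $C$, independent of $L$ and of the code, such that $d\ge cL^\alpha$ implies $\Delta_{\max}\le C L^{\beta}$ with $\beta=D-1-\frac{\alpha}{D-1}$. That is, if $d=\Omega(L^\alpha)$ then $\Delta_{\max}=O(L^\beta)$. -/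

import Mathlib

open scoped ENNReal

noncomputable section

namespace SubsystemCode

/-! ### Pauli operators modulo phases -/

/-- Pauli operators on the set of qubits `Q`, modulo phases, as a vector space over the field with
two elements. The component `x q = (a, b)` stands for the operator `X ^ a * Z ^ b` on qubit `q`. -/
abbrev Pauli (Q : Type) : Type := Q → ZMod 2 × ZMod 2

variable {Q : Type} [Fintype Q]

/-- The symplectic form: `0` if the two Pauli operators commute, `1` if they anticommute. -/
def symp (x y : Pauli Q) : ZMod 2 := ∑ q, ((x q).1 * (y q).2 + (x q).2 * (y q).1)

/-- The weight of a Pauli operator: the number of qubits on which it acts nontrivially. -/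
def weight (x : Pauli Q) : ℕ := (Finset.univ.filter fun q => x q ≠ 0).card

/-- The Pauli operators that commute with all elements of `G`. -/
def perp (G : Submodule (ZMod 2) (Pauli Q)) : Submodule (ZMod 2) (Pauli Q) where
  carrier := {x | ∀ g ∈ G, symp x g = 0}
  zero_mem' := by intro g _; simp [symp]
  add_mem' := by
    intro x y hx hy g hg
    have h : symp (x + y) g = symp x g + symp y g := by
      simp only [symp, ← Finset.sum_add_distrib]
      refine Finset.sum_congr rfl fun q _ => ?_
      simp only [Pi.add_apply, Prod.fst_add, Prod.snd_add]
      ring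
    rw [h, hx g hg, hy g hg, add_zero]
  smul_mem' := by
    intro c x hx g hg
    have h : symp (c • x) g = c * symp x g := by
      simp only [symp, Finset.mul_sum]
      refine Finset.sum_congr rfl fun q _ => ?_
      simp only [Pi.smul_apply, Prod.smul_fst, Prod.smul_snd, smul_eq_mul]
      ring
    rw [h, hx g hg, mul_zero]

/-! ### Subsystem codes

A subsystem code is given by its gauge group `G`, a subspace of the space of Pauli operators. -/

/-- The stabilizer group `S = G ∩ G^⊥` of the subsystem code with gauge group `G`. -/
def stabilizer (G : Submodule (ZMod 2) (Pauli Q)) : Submodule (ZMod 2) (Pauli Q) := G ⊓ perp G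

/-- The dressed logical operators `S^⊥` (nontrivial if they are not in `G`). -/
def dressed (G : Submodule (ZMod 2) (Pauli Q)) : Submodule (ZMod 2) (Pauli Q) :=
  perp (stabilizer G)

/-- The code distance: the minimum weight of a nontrivial dressed logical operator, an element of
`S^⊥ \ G`. It is `⊤` if there is none, that is, if the code protects no qubits. -/
def distance (G : Submodule (ZMod 2) (Pauli Q)) : ℕ∞ :=
  ⨅ x ∈ {x : Pauli Q | x ∈ dressed G ∧ x ∉ G}, (weight x : ℕ∞)

/-! ### Geometric locality -/

/-- The sites of a `D`-dimensional hypercubic lattice of linear size `L`. -/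
abbrev Site (D L : ℕ) : Type := Fin D → Fin L

/-- The boundary conditions of the lattice. -/
inductive Boundary where
  | opened
  | periodic

/-- The site `q` lies in the hypercube with linear size `w` and corner `c`
(which wraps around the lattice if the boundary conditions are periodic). -/
def InCube {D L : ℕ} (bc : Boundary) (w : ℕ) (c q : Site D L) : Prop :=
  match bc with
  | .opened => ∀ i, ∃ k < w, (q i : ℕ) = (c i : ℕ) + k
  | .periodic => ∀ i, ∃ k < w, (q i : ℕ) = ((c i : ℕ) + k) % L

/-- `x` acts nontrivially only inside some hypercube with linear size `w`. -/
def IsLocal {D L : ℕ} (bc : Boundary) (w : ℕ) (x : Pauli (Site D L)) : Prop :=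
  ∃ c : Site D L, ∀ q, x q ≠ 0 → InCube bc w c q

/-- The group `G` has a set of generators that are local with interaction range `w`. -/
def HasLocalGenerators {D L : ℕ} (bc : Boundary) (w : ℕ)
    (G : Submodule (ZMod 2) (Pauli (Site D L))) : Prop :=
  ∃ T : Set (Pauli (Site D L)), Submodule.span (ZMod 2) T = G ∧ ∀ t ∈ T, IsLocal bc w t

/-- `s` is a (possibly overcomplete) family of generators of the stabilizer group of the code with
gauge group `G`, each local with interaction range `w`, such that at most `m` of them act
nontrivially on any given qubit. -/
structure IsLocalStabilizerFamily {D L N : ℕ} (bc : Boundary) (w m : ℕ)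
    (G : Submodule (ZMod 2) (Pauli (Site D L))) (s : Fin N → Pauli (Site D L)) : Prop where
  span_eq : Submodule.span (ZMod 2) (Set.range s) = stabilizer G
  isLocal : ∀ a, IsLocal bc w (s a)
  card_le : ∀ q, (Finset.univ.filter fun a => s a q ≠ 0).card ≤ m

/-! ### Energies -/

/-- `E(x)`: the number of members of the family `s` that anticommute with `x`. By
`hamiltonian_pauliOp` below, this is the eigenvalue of the Hamiltonian `-∑ a, (S_a - 1) / 2` on
`x ψ`, for every zero-energy state `ψ`. -/
def energy {N : ℕ} (s : Fin N → Pauli Q) (x : Pauli Q) : ℕ :=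
  (Finset.univ.filter fun a => symp x (s a) = 1).card

/-- The sign `(-1) ^ a`. -/
def sgn (a : ZMod 2) : ℂ := if a = 0 then 1 else -1

/-- The Hermitian Pauli operator with class `x` on the Hilbert space of the qubits, whose vectors
are functions of bit strings: the tensor product over `q` of `i ^ (a b) X ^ a Z ^ b`,
where `(a, b) = x q`. -/
def pauliOp (x : Pauli Q) (ψ : (Q → ZMod 2) → ℂ) : (Q → ZMod 2) → ℂ := fun u =>
  Complex.I ^ (Finset.univ.filter fun q => x q = (1, 1)).card *
    sgn (∑ q, (x q).2 * (u q + (x q).1)) * ψ fun q => u q + (x q).1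

/-- The Hamiltonian `-∑ a, (S_a - 1) / 2`, where `S_a = ε a • pauliOp (s a)` with a sign `ε a`. -/
def hamiltonian {N : ℕ} (ε : Fin N → ℤˣ) (s : Fin N → Pauli Q) (ψ : (Q → ZMod 2) → ℂ) :
    (Q → ZMod 2) → ℂ :=
  -∑ a, (1 / 2 : ℂ) • (((ε a : ℤ) : ℂ) • pauliOp (s a) ψ - ψ)

lemma sgn_add (a b : ZMod 2) : sgn (a + b) = sgn a * sgn b := by
  have h2 : ∀ c : ZMod 2, c = 0 ∨ c = 1 := by decide
  have h3 : (1 + 1 : ZMod 2) = 0 := by decide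
  rcases h2 a with rfl | rfl <;> rcases h2 b with rfl | rfl <;> simp [sgn, h3]

lemma pauliOp_comm (x y : Pauli Q) (ψ : (Q → ZMod 2) → ℂ) :
    pauliOp y (pauliOp x ψ) = sgn (symp x y) • pauliOp x (pauliOp y ψ) := by
  funext u
  have hu : (fun q => u q + (y q).1 + (x q).1) = fun q => u q + (x q).1 + (y q).1 := by
    funext q; ring
  have hs : sgn (∑ q, (y q).2 * (u q + (y q).1)) * sgn (∑ q, (x q).2 * (u q + (y q).1 + (x q).1))
      = sgn (symp x y) * (sgn (∑ q, (x q).2 * (u q + (x q).1)) *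
        sgn (∑ q, (y q).2 * (u q + (x q).1 + (y q).1))) := by
    simp only [← sgn_add, symp, ← Finset.sum_add_distrib]
    congr 1
    refine Finset.sum_congr rfl fun q _ => ?_
    generalize (x q).1 = a
    generalize (x q).2 = b
    generalize (y q).1 = c
    generalize (y q).2 = d
    generalize u q = e
    revert a b c d e
    decide
  simp only [pauliOp, Pi.smul_apply, smul_eq_mul, hu]
  linear_combination (Complex.I ^ (Finset.univ.filter fun q => x q = (1, 1)).card *
    Complex.I ^ (Finset.univ.filter fun q => y q = (1, 1)).card *
    ψ (fun q => u q + (x q).1 + (y q).1)) * hs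

lemma pauliOp_smul (x : Pauli Q) (c : ℂ) (ψ : (Q → ZMod 2) → ℂ) :
    pauliOp x (c • ψ) = c • pauliOp x ψ := by
  funext u
  simp only [pauliOp, Pi.smul_apply, smul_eq_mul]
  ring

/-- If `ψ` is a simultaneous eigenstate with eigenvalue one of all `S_a`, then `x ψ` is an
eigenstate of the Hamiltonian with eigenvalue `E(x)`. -/
lemma hamiltonian_pauliOp {N : ℕ} (ε : Fin N → ℤˣ) (s : Fin N → Pauli Q)
    (ψ : (Q → ZMod 2) → ℂ) (h : ∀ a, ((ε a : ℤ) : ℂ) • pauliOp (s a) ψ = ψ) (x : Pauli Q) :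
    hamiltonian ε s (pauliOp x ψ) = (energy s x : ℂ) • pauliOp x ψ := by
  have h1 : ∀ a, (1 / 2 : ℂ) • (((ε a : ℤ) : ℂ) • pauliOp (s a) (pauliOp x ψ) - pauliOp x ψ)
      = (if symp x (s a) = 1 then (-1 : ℂ) else 0) • pauliOp x ψ := by
    intro a
    rw [pauliOp_comm, smul_comm, ← pauliOp_smul, h a]
    have h2 : ∀ c : ZMod 2, c = 0 ∨ c = 1 := by decide
    rcases h2 (symp x (s a)) with h0 | h0
    · simp [h0, sgn]
    · simp only [h0, sgn, one_ne_zero, if_false, if_true]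
      module
  simp only [hamiltonian, h1, ← Finset.sum_smul, energy]
  rw [← neg_smul]
  congr 1
  rw [← Finset.sum_filter]
  simp

/-! ### Energy barriers -/

/-- `γ 0, …, γ t` is a walk on the Pauli group from the identity to `z`, in which successive
elements differ by an operator of weight one. -/
def IsWalk (z : Pauli Q) (t : ℕ) (γ : ℕ → Pauli Q) : Prop :=
  γ 0 = 0 ∧ γ t = z ∧ ∀ i < t, weight (γ (i + 1) - γ i) = 1

/-- The largest energy along the walk `γ 0, …, γ t`. -/
def maxEnergy {N : ℕ} (s : Fin N → Pauli Q) (t : ℕ) (γ : ℕ → Pauli Q) : ℕ :=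
  (Finset.range (t + 1)).sup fun i => energy s (γ i)

/-- `Δ(z)`: the minimum, over all walks from the identity to `z`, of the largest energy along the
walk. (Such walks exist, see `exists_isWalk`.) -/
def barrier {N : ℕ} (s : Fin N → Pauli Q) (z : Pauli Q) : ℕ :=
  sInf {e | ∃ t γ, IsWalk z t γ ∧ maxEnergy s t γ = e}

/-- `Δ_max`: the maximum over dressed logical operators `x` of the minimum over `y ∈ G` of
`Δ(x y)`. (Both range over finite nonempty sets.) -/
def barrierMax {N : ℕ} (G : Submodule (ZMod 2) (Pauli Q)) (s : Fin N → Pauli Q) : ℕ :=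
  ⨆ x : dressed G, ⨅ y : G, barrier s ((x : Pauli Q) + (y : Pauli Q))

lemma exists_isWalk (z : Pauli Q) : ∃ t γ, IsWalk z t γ := by
  classical
  suffices H : ∀ A : Finset Q, ∃ t γ, IsWalk (fun q => if q ∈ A then z q else 0) t γ by
    simpa using H Finset.univ
  intro A
  induction A using Finset.induction_on with
  | empty => exact ⟨0, fun _ => 0, rfl, by funext q; simp, by simp⟩
  | insert a A ha ih =>
    obtain ⟨t, γ, h0, ht, hs⟩ := ih
    by_cases hz : z a = 0
    · refine ⟨t, γ, h0, ?_, hs⟩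
      rw [ht]
      funext q
      by_cases hq : q = a
      · subst hq; simp [ha, hz]
      · simp [hq]
    · refine ⟨t + 1, fun i => if i ≤ t then γ i else fun q => if q ∈ insert a A then z q else 0,
        by simpa using h0, by simp, ?_⟩
      intro i hi
      rcases Nat.lt_succ_iff_lt_or_eq.mp hi with hi | rfl
      · have h1 : i + 1 ≤ t := hi
        simp only [h1, hi.le, if_true]
        exact hs i hi
      · have h1 : ¬ (i + 1 ≤ i) := by omega
        simp only [h1, le_refl, if_true, if_false, ht]
        unfold weight
        rw [Finset.card_eq_one]
        refine ⟨a, ?_⟩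
        ext q
        by_cases hq : q = a
        · subst hq; simp [ha, hz]
        · simp [hq]

end SubsystemCode

end

noncomputable section

namespace SubsystemCode

/-! ### Symplectic duality, cleaning, and logical operators on shells and cells. -/

section Symplectic

variable {Q : Type} [Fintype Q]

/-! Write `d` for the distance. The proof moves a dressed logical operator by gauge operators onto a
sparse network of walls of constant thickness and spacing about `R`, where it can be built cheaply.

To clear the cells between the walls, cleaning duality (`exists_add_trivialOn`) asks that every bare
logical operator (element of `G^⊥`) supported on the cells lie in `G`. Cells decouple since no gauge
generator crosses a wall (`mem_of_cells`). For one cell, take nested cubes growing by constant steps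
up to radius `O(R)`; their shells have `O(R^(D-1))` sites. If this is below `d`, stabilizers clean a
bare operator off a shell; it then splits into an inner piece, treated by induction, and an outer
piece on the next shell, which is in `G` because that shell is too small (`mem_of_shells`).

An operator on the walls is built by a front moving in one direction (`barrier_le_walls`). Violated
generators stay near the front, which meets the transversal walls in `O((L/R) L^(D-2))` sites. A
wall parallel to the front would cost `L^(D-1)` if swallowed at once, so it is built column by
column, at cost `O(L^(D-2))`.

The barrier is thus `O(L^(D-1)/R)`, and the distance allows `R` of order `L^(α/(D-1))`. If that `R`
is too small for walls, sweeping by a plain hyperplane suffices. If `α > D-1`, large lattices encode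
nothing and `L` is otherwise bounded. For `D = 2`, `α = 1` the exponent is zero. -/

lemma symp_comm (x y : Pauli Q) : symp x y = symp y x :=
  Finset.sum_congr rfl fun q _ => by ring

lemma symp_add_left (x y z : Pauli Q) : symp (x + y) z = symp x z + symp y z := by
  simp only [symp, ← Finset.sum_add_distrib]
  refine Finset.sum_congr rfl fun q _ => ?_
  simp only [Pi.add_apply, Prod.fst_add, Prod.snd_add]
  ring

lemma symp_smul_left (c : ZMod 2) (x y : Pauli Q) : symp (c • x) y = c * symp x y := by
  simp only [symp, Finset.mul_sum]
  refine Finset.sum_congr rfl fun q _ => ?_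
  simp only [Pi.smul_apply, Prod.smul_fst, Prod.smul_snd, smul_eq_mul]
  ring

lemma symp_eq_zero_of_disjoint {x y : Pauli Q} (h : ∀ q, x q ≠ 0 → y q = 0) : symp x y = 0 := by
  refine Finset.sum_eq_zero fun q _ => ?_
  by_cases hq : x q = 0
  · simp [hq]
  · simp [h q hq]

/-- The symplectic form as a bilinear form. -/
def sympForm : LinearMap.BilinForm (ZMod 2) (Pauli Q) :=
  LinearMap.mk₂ (ZMod 2) symp symp_add_left symp_smul_left
    (fun x y z => by rw [symp_comm, symp_add_left, symp_comm y, symp_comm z])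
    (fun c x y => by rw [symp_comm, symp_smul_left, symp_comm y]; rfl)

lemma sympForm_apply (x y : Pauli Q) : sympForm x y = symp x y := rfl

lemma eq_zero_at_of_symp {x : Pauli Q} {q : Q}
    (h : ∀ y : Pauli Q, (∀ r, r ≠ q → y r = 0) → symp x y = 0) : x q = 0 := by
  classical
  have key : ∀ p : ZMod 2 × ZMod 2, symp x (Pi.single q p) =
      (x q).1 * p.2 + (x q).2 * p.1 := by
    intro p
    unfold symp
    rw [Finset.sum_eq_single q]
    · simp
    · intro b _ hb
      simp [Pi.single_eq_of_ne hb]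
    · simp
  have h1 := key (0, 1)
  have h2 := key (1, 0)
  rw [h _ fun r hr => Pi.single_eq_of_ne hr _] at h1 h2
  ext
  · simpa using h1.symm
  · simpa using h2.symm

lemma sympForm_isRefl : (sympForm (Q := Q)).IsRefl := fun x y h => by
  rw [sympForm_apply] at h ⊢
  rwa [symp_comm]

lemma sympForm_nondegenerate : (sympForm (Q := Q)).Nondegenerate :=
  (sympForm_isRefl.nondegenerate_iff_separatingLeft).2 fun _ hx =>
    funext fun _ => eq_zero_at_of_symp fun y _ => hx y

lemma perp_eq_orthogonal (U : Submodule (ZMod 2) (Pauli Q)) :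
    perp U = sympForm.orthogonal U := by
  ext x
  rw [LinearMap.BilinForm.mem_orthogonal_iff]
  refine forall₂_congr fun g _ => ?_
  rw [sympForm_apply, symp_comm]

lemma perp_perp (U : Submodule (ZMod 2) (Pauli Q)) : perp (perp U) = U := by
  rw [perp_eq_orthogonal, perp_eq_orthogonal,
    LinearMap.BilinForm.orthogonal_orthogonal sympForm_nondegenerate sympForm_isRefl]

lemma perp_anti {U V : Submodule (ZMod 2) (Pauli Q)} (h : U ≤ V) : perp V ≤ perp U :=
  fun _ hx g hg => hx g (h hg)

lemma mem_perp_span {T : Set (Pauli Q)} {x : Pauli Q} :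
    x ∈ perp (Submodule.span (ZMod 2) T) ↔ ∀ t ∈ T, symp x t = 0 := by
  refine ⟨fun h t ht => h t (Submodule.subset_span ht), fun h => ?_⟩
  have h1 : Submodule.span (ZMod 2) T ≤ perp (Submodule.span (ZMod 2) {x}) := by
    rw [Submodule.span_le]
    intro t ht g hg
    obtain ⟨c, rfl⟩ := Submodule.mem_span_singleton.1 hg
    rw [symp_comm, symp_smul_left, h t ht, mul_zero]
  intro g hg
  rw [symp_comm]
  exact h1 hg x (Submodule.mem_span_singleton_self x)

/-- The Pauli operators that act trivially on `M`. -/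
def trivialOn (M : Set Q) : Submodule (ZMod 2) (Pauli Q) where
  carrier := {x | ∀ q ∈ M, x q = 0}
  zero_mem' := fun _ _ => rfl
  add_mem' := fun hx hy q hq => by simp [hx q hq, hy q hq]
  smul_mem' := fun c x hx q hq => by simp [hx q hq]

/-- The cleaning lemma: if the elements of `U^⊥` supported on `M` lie in `V`, then the elements of
`V^⊥` can be moved off `M` by elements of `U`. -/
lemma exists_add_trivialOn {U V : Submodule (ZMod 2) (Pauli Q)} {M : Set Q}
    (h : ∀ x ∈ perp U, (∀ q, q ∉ M → x q = 0) → x ∈ V) {y : Pauli Q} (hy : y ∈ perp V) :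
    ∃ u ∈ U, ∀ q ∈ M, (y + u) q = 0 := by
  -- Commuting with every operator trivial on `M` forces support inside `M`. Taking `perp` of this
  -- inclusion gives `V^⊥ ≤ U + trivialOn M`.
  have h1 : perp (U ⊔ trivialOn M) ≤ V := fun x hx =>
    h x (perp_anti le_sup_left hx) fun q hq =>
      eq_zero_at_of_symp fun z hz => hx z (Submodule.mem_sup_right fun r hr =>
        hz r (by rintro rfl; exact hq hr))
  have h2 := perp_anti h1 hy
  rw [perp_perp] at h2
  obtain ⟨u, hu, p, hp, rfl⟩ := Submodule.mem_sup.1 h2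
  refine ⟨-u, U.neg_mem hu, fun q hq => ?_⟩
  simpa using hp q hq

lemma stabilizer_le_perp (G : Submodule (ZMod 2) (Pauli Q)) : stabilizer G ≤ perp G := inf_le_right

lemma perp_le_dressed (G : Submodule (ZMod 2) (Pauli Q)) : perp G ≤ dressed G :=
  perp_anti inf_le_left

lemma le_dressed (G : Submodule (ZMod 2) (Pauli Q)) : G ≤ dressed G := by
  conv_lhs => rw [← perp_perp G]
  exact perp_anti inf_le_right

lemma mem_of_weight_lt_distance {G : Submodule (ZMod 2) (Pauli Q)} {x : Pauli Q}
    (hx : x ∈ dressed G) (h : (weight x : ℕ∞) < distance G) : x ∈ G := by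
  by_contra hG
  exact absurd h (not_lt.2 (iInf₂_le x ⟨hx, hG⟩))

lemma mem_of_card_lt_distance {G : Submodule (ZMod 2) (Pauli Q)} {x : Pauli Q}
    (hx : x ∈ dressed G) (A : Finset Q) (hA : ∀ q, q ∉ A → x q = 0)
    (h : (A.card : ℕ∞) < distance G) : x ∈ G := by
  refine mem_of_weight_lt_distance hx (lt_of_le_of_lt ?_ h)
  refine Nat.cast_le.2 (Finset.card_le_card fun q hq => ?_)
  by_contra hqA
  exact (Finset.mem_filter.1 hq).2 (hA q hqA)

/-- On the support of each generator, `A` keeps either all of `x` or nothing, so the symplectic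
product is unchanged or zero. -/
lemma indicator_mem_perp_span {T : Set (Pauli Q)} {x : Pauli Q}
    (hx : x ∈ perp (Submodule.span (ZMod 2) T)) {A : Set Q}
    (hA : ∀ t ∈ T, ∀ q q', t q ≠ 0 → t q' ≠ 0 → x q ≠ 0 → x q' ≠ 0 → q ∈ A → q' ∈ A) :
    A.indicator x ∈ perp (Submodule.span (ZMod 2) T) := by
  classical
  rw [mem_perp_span] at hx ⊢
  intro t ht
  by_cases h : ∃ q ∈ A, t q ≠ 0 ∧ x q ≠ 0
  · obtain ⟨q, hq, htq, hxq⟩ := h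
    rw [← hx t ht]
    refine Finset.sum_congr rfl fun q' _ => ?_
    by_cases hq' : q' ∈ A
    · rw [Set.indicator_of_mem hq']
    · rw [Set.indicator_of_notMem hq']
      by_cases htq' : t q' = 0
      · simp [htq']
      · by_cases hxq' : x q' = 0
        · simp [hxq']
        · exact absurd (hA t ht q q' htq htq' hxq hxq' hq) hq'
  · push Not at h
    refine symp_eq_zero_of_disjoint fun q hq => ?_
    by_contra htq
    have hqA : q ∈ A := Set.mem_of_indicator_ne_zero hq
    rw [Set.indicator_of_mem hqA] at hq
    exact hq (h q hqA htq)

/-- If `K 0 = ∅`, `K 1`, … is a growing chain of regions, such that each contains the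
neighbourhood of the previous one and the shells between successive regions support no nontrivial
dressed logical operators, then the regions support no nontrivial bare logical operators. -/
lemma mem_of_shells {N : ℕ} {G : Submodule (ZMod 2) (Pauli Q)} {s : Fin N → Pauli Q}
    {T : Set (Pauli Q)} (hT : Submodule.span (ZMod 2) T = G)
    (hs : Submodule.span (ZMod 2) (Set.range s) = stabilizer G)
    (near : Q → Q → Prop)
    (hTn : ∀ t ∈ T, ∀ q q', t q ≠ 0 → t q' ≠ 0 → near q q')
    (hsn : ∀ a q q', s a q ≠ 0 → s a q' ≠ 0 → near q q')
    {K : ℕ → Set Q} (h0 : K 0 = ∅) (hmono : ∀ i, K i ⊆ K (i + 1))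
    (hK : ∀ i q q', q ∈ K i → near q q' → q' ∈ K (i + 1)) {n : ℕ}
    (hd : ∀ i ≤ n, ∀ x ∈ dressed G, (∀ q, q ∉ K (i + 1) \ K i → x q = 0) → x ∈ G) :
    ∀ i ≤ n, ∀ x ∈ perp G, (∀ q, q ∉ K i → x q = 0) → x ∈ G := by
  intro i
  induction i with
  | zero =>
    intro _ x _ hx
    have : x = 0 := funext fun q => hx q (by simp [h0])
    rw [this]
    exact G.zero_mem
  | succ i ih =>
    intro hi x hx hxK
    -- Cleaning with `U` the stabilizer group and `V = G`: multiplying by stabilizers keeps `x`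
    -- bare.
    obtain ⟨u, hu, hux⟩ := exists_add_trivialOn (hd i (by omega)) hx
    -- Only the stabilizer generators that meet the shell matter there; keeping just these confines
    -- the correction to `K (i + 2)`.
    obtain ⟨u₁, hu₁, hu₁K, hu₁M⟩ : ∃ u₁ ∈ stabilizer G, (∀ q, q ∉ K (i + 2) → u₁ q = 0) ∧
        ∀ q ∈ K (i + 1) \ K i, u₁ q = u q := by
      set M := K (i + 1) \ K i
      have hsplit : Set.range s ⊆
          ((stabilizer G ⊓ trivialOn (K (i + 2))ᶜ) ⊔ (trivialOn M) :
            Submodule (ZMod 2) (Pauli Q)) := by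
        rintro _ ⟨a, rfl⟩
        by_cases h : ∃ q ∈ M, s a q ≠ 0
        · obtain ⟨q, hq, hqa⟩ := h
          refine Submodule.mem_sup_left ⟨?_, fun q' hq' => ?_⟩
          · rw [← hs]
            exact Submodule.subset_span ⟨a, rfl⟩
          · by_contra hne
            exact hq' (hK _ _ _ hq.1 (hsn a _ _ hqa hne))
        · push Not at h
          exact Submodule.mem_sup_right h
      rw [← hs] at hu
      obtain ⟨u₁, hu₁, u₂, hu₂, rfl⟩ := Submodule.mem_sup.1 (Submodule.span_le.2 hsplit hu)
      refine ⟨u₁, hu₁.1, fun q hq => hu₁.2 q hq, fun q hq => ?_⟩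
      simp [hu₂ q hq]
    have hy : x + u₁ ∈ perp G := (perp G).add_mem hx (stabilizer_le_perp G hu₁)
    have hyM : ∀ q ∈ K (i + 1) \ K i, (x + u₁) q = 0 := fun q hq => by
      rw [Pi.add_apply, hu₁M q hq]
      exact hux q hq
    have hyK : ∀ q, q ∉ K (i + 2) → (x + u₁) q = 0 := fun q hq => by
      rw [Pi.add_apply, hu₁K q hq, hxK q fun h => hq (hmono _ h), add_zero]
    -- The emptied shell is too thick for a gauge generator to bridge, so the inner part commutes
    -- with `G` by itself.
    have hy₁ : (K i).indicator (x + u₁) ∈ perp G := by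
      subst hT
      refine indicator_mem_perp_span hy fun t ht q q' htq htq' _ hxq' hq => ?_
      by_contra hq'
      exact hxq' (hyM q' ⟨hK _ _ _ hq (hTn t ht _ _ htq htq'), hq'⟩)
    have hsum : (K i).indicator (x + u₁) + (K i)ᶜ.indicator (x + u₁) = x + u₁ :=
      Set.indicator_self_add_compl _ _
    have hy₂ : (K i)ᶜ.indicator (x + u₁) ∈ perp G := by
      rw [← hsum] at hy
      exact ((perp G).add_mem_iff_right hy₁).1 hy
    have hg₁ := ih (by omega) _ hy₁ fun q hq => Set.indicator_of_notMem hq _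
    have hg₂ : (K i)ᶜ.indicator (x + u₁) ∈ G := by
      -- The outer part lives on the next shell, `K (i + 2) \ K (i + 1)`; this is why the hypothesis
      -- includes index `n`.
      refine hd (i + 1) hi _ (perp_le_dressed G hy₂) fun q hq => ?_
      by_cases h1 : q ∈ K i
      · exact Set.indicator_of_notMem (by simpa using h1) _
      · rw [Set.indicator_of_mem h1]
        by_cases h2 : q ∈ K (i + 1)
        · exact hyM q ⟨h2, h1⟩
        · exact hyK q fun h => hq ⟨h, h2⟩
    have hg := G.add_mem hg₁ hg₂
    rw [hsum] at hg
    exact (G.add_mem_iff_left hu₁.1).1 hg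

/-- If no gauge generator acts on two cells of a region, and no cell supports a nontrivial bare
logical operator, then neither does the region. -/
lemma mem_of_cells {ι : Type} {G : Submodule (ZMod 2) (Pauli Q)} {T : Set (Pauli Q)}
    (hT : Submodule.span (ZMod 2) T = G) {M : Set Q} (cell : Q → ι)
    (hcell : ∀ t ∈ T, ∀ q ∈ M, ∀ q' ∈ M, t q ≠ 0 → t q' ≠ 0 → cell q = cell q')
    (h : ∀ j, ∀ y ∈ perp G, (∀ q, ¬ (q ∈ M ∧ cell q = j) → y q = 0) → y ∈ G)
    {x : Pauli Q} (hx : x ∈ perp G) (hxM : ∀ q, q ∉ M → x q = 0) : x ∈ G := by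
  classical
  have hsum : x = ∑ j ∈ Finset.univ.image cell, (cell ⁻¹' {j}).indicator x := by
    funext q
    rw [Finset.sum_apply, Finset.sum_eq_single (cell q)]
    · simp
    · intro j _ hj
      exact Set.indicator_of_notMem (fun hq => hj (by simpa using hq.symm)) _
    · simp
  rw [hsum]
  refine G.sum_mem fun j _ => h j _ ?_ fun q hq => ?_
  · subst hT
    refine indicator_mem_perp_span hx fun t ht q q' htq htq' hxq hxq' hq => ?_
    have hM : ∀ r, x r ≠ 0 → r ∈ M := fun r hr => by
      by_contra hrM
      exact hr (hxM r hrM)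
    have := hcell t ht q (hM q hxq) q' (hM q' hxq') htq htq'
    simpa [← this] using hq
  · by_cases hj : cell q = j
    · rw [Set.indicator_of_mem (by simpa using hj)]
      exact hxM q fun hM => hq ⟨hM, hj⟩
    · exact Set.indicator_of_notMem (by simpa using hj) _

end Symplectic

/-! ### Energies of truncated operators, and walks that sweep the qubits. -/

section Energy

variable {Q : Type} [Fintype Q] {N : ℕ} {s : Fin N → Pauli Q}

lemma energy_zero : energy s 0 = 0 := by
  simp [energy, symp]

lemma energy_add_le (x y : Pauli Q) : energy s (x + y) ≤ energy s x + energy s y := by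
  classical
  refine (Finset.card_le_card fun a ha => ?_).trans (Finset.card_union_le _ _)
  rw [Finset.mem_union, Finset.mem_filter, Finset.mem_filter]
  rw [Finset.mem_filter, symp_add_left] at ha
  have h2 : ∀ c d : ZMod 2, c + d = 1 → c = 1 ∨ d = 1 := by decide
  exact (h2 _ _ ha.2).imp (fun h => ⟨Finset.mem_univ _, h⟩) fun h => ⟨Finset.mem_univ _, h⟩

variable {m : ℕ}

/-- If every violated generator acts on `B`, then the energy is at most `m * #B`. -/
lemma energy_le_mul_card (hm : ∀ q, (Finset.univ.filter fun a => s a q ≠ 0).card ≤ m)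
    {x : Pauli Q} {B : Finset Q} (h : ∀ a, symp x (s a) = 1 → ∃ q ∈ B, s a q ≠ 0) :
    energy s x ≤ m * B.card := by
  classical
  calc energy s x ≤ (B.biUnion fun q => Finset.univ.filter fun a => s a q ≠ 0).card := by
        refine Finset.card_le_card fun a ha => ?_
        obtain ⟨q, hq, hqa⟩ := h a (Finset.mem_filter.1 ha).2
        exact Finset.mem_biUnion.2 ⟨q, hq, Finset.mem_filter.2 ⟨Finset.mem_univ _, hqa⟩⟩
    _ ≤ B.card * m := Finset.card_biUnion_le_card_mul _ _ _ fun q _ => hm q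
    _ = m * B.card := mul_comm _ _

lemma exists_ne_zero_of_symp {x y : Pauli Q} (h : symp x y = 1) : ∃ q, x q ≠ 0 ∧ y q ≠ 0 := by
  by_contra hc
  push Not at hc
  rw [symp_eq_zero_of_disjoint hc] at h
  exact zero_ne_one h

lemma energy_le_mul_card_of_support
    (hm : ∀ q, (Finset.univ.filter fun a => s a q ≠ 0).card ≤ m)
    {x : Pauli Q} {B : Finset Q} (h : ∀ q, x q ≠ 0 → q ∈ B) : energy s x ≤ m * B.card :=
  energy_le_mul_card hm fun _ ha =>
    let ⟨q, hx, hs⟩ := exists_ne_zero_of_symp ha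
    ⟨q, h q hx, hs⟩

/-- The energy of the restriction of a zero-energy operator `z` to `A` is at most `m` times the size
of a set that meets every pair of neighbours in the support of `z` separated by `A`. -/
lemma energy_indicator_le (hm : ∀ q, (Finset.univ.filter fun a => s a q ≠ 0).card ≤ m)
    {near : Q → Q → Prop} (hsn : ∀ a q q', s a q ≠ 0 → s a q' ≠ 0 → near q q')
    {z : Pauli Q} (hz : ∀ a, symp z (s a) = 0) {A : Set Q} {B : Finset Q}
    (hB : ∀ q ∈ A, ∀ q', q' ∉ A → z q ≠ 0 → z q' ≠ 0 → near q q' → q ∈ B ∨ q' ∈ B) :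
    energy s (A.indicator z) ≤ m * B.card := by
  refine energy_le_mul_card hm fun a ha => ?_
  -- As `z` commutes with `s a`, a violation by the part in `A` is matched by one from the
  -- complement, so `s a` meets the support on both sides.
  have hc : symp (Aᶜ.indicator z) (s a) = 1 := by
    have h := hz a
    rw [← Set.indicator_self_add_compl A z, symp_add_left, ha] at h
    have h2 : ∀ c : ZMod 2, 1 + c = 0 → c = 1 := by decide
    exact h2 _ h
  obtain ⟨q, hq, hqa⟩ := exists_ne_zero_of_symp ha
  obtain ⟨q', hq', hqa'⟩ := exists_ne_zero_of_symp hc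
  have hqA : q ∈ A := Set.mem_of_indicator_ne_zero hq
  have hqA' : q' ∈ Aᶜ := Set.mem_of_indicator_ne_zero hq'
  rw [Set.indicator_of_mem hqA] at hq
  rw [Set.indicator_of_mem hqA'] at hq'
  rcases hB q hqA q' hqA' hq hq' (hsn a q q' hqa hqa') with h | h
  · exact ⟨q, h, hqa⟩
  · exact ⟨q', h, hqa'⟩

/-- `x` is the endpoint of a walk of energy at most `E`. -/
def ReachableWithin (s : Fin N → Pauli Q) (E : ℕ) (x : Pauli Q) : Prop :=
  ∃ t γ, IsWalk x t γ ∧ maxEnergy s t γ ≤ E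

lemma barrier_le {E : ℕ} {z : Pauli Q} (h : ReachableWithin s E z) : barrier s z ≤ E := by
  obtain ⟨t, γ, hγ, hE⟩ := h
  exact le_trans (show barrier s z ≤ maxEnergy s t γ from Nat.sInf_le ⟨t, γ, hγ, rfl⟩) hE

lemma reachableWithin_zero (E : ℕ) : ReachableWithin s E 0 :=
  ⟨0, fun _ => 0, ⟨rfl, rfl, by simp⟩, by simp [maxEnergy, energy_zero]⟩

lemma ReachableWithin.step {E : ℕ} {x y : Pauli Q} (h : ReachableWithin s E x)
    (hxy : weight (y - x) = 1) (hy : energy s y ≤ E) : ReachableWithin s E y := by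
  obtain ⟨t, γ, ⟨h0, ht, hs⟩, hE⟩ := h
  refine ⟨t + 1, fun i => if i ≤ t then γ i else y, ⟨by simpa using h0, by simp, ?_⟩, ?_⟩
  · intro i hi
    rcases Nat.lt_succ_iff_lt_or_eq.mp hi with hi | rfl
    · have h1 : i + 1 ≤ t := hi
      simpa only [h1, hi.le, if_true] using hs i hi
    · have h1 : ¬ (i + 1 ≤ i) := by omega
      simpa only [h1, le_refl, if_true, if_false, ht] using hxy
  · refine Finset.sup_le fun i _ => ?_
    by_cases hi : i ≤ t
    · simp only [hi, if_true]
      exact (Finset.le_sup (f := fun i => energy s (γ i))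
        (Finset.mem_range.2 (Nat.lt_succ_of_le hi))).trans hE
    · simpa only [hi, if_false] using hy

/-- The sites of `B` are added one at a time. Each intermediate operator is compared with the
starting point, of energy at most `e`, and not with the bound `E` on the whole walk; hence costs do
not accumulate over successive uses. -/
lemma ReachableWithin.indicator_union
    (hm : ∀ q, (Finset.univ.filter fun a => s a q ≠ 0).card ≤ m) {E e : ℕ} {z : Pauli Q}
    {A : Set Q} (h : ReachableWithin s E (A.indicator z)) (hA : energy s (A.indicator z) ≤ e)
    (B : Finset Q) (hB : e + m * B.card ≤ E) :
    ReachableWithin s E ((A ∪ B : Set Q).indicator z) := by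
  classical
  induction B using Finset.induction_on with
  | empty => simpa using h
  | insert a B ha ih =>
    rw [Finset.card_insert_of_notMem ha] at hB
    have ih := ih (le_trans (by gcongr; omega) hB)
    by_cases hz : z a = 0 ∨ a ∈ A
    · convert ih using 1
      funext q
      by_cases hq : q = a
      · subst hq
        rcases hz with hz | hz
        · simp [Set.indicator_apply, hz]
        · simp [hz]
      · simp only [Set.indicator_apply, Set.mem_union, Finset.coe_insert, Set.mem_insert_iff, hq,
          false_or]
    · push Not at hz
      refine ih.step ?_ ?_
      · unfold weight
        rw [Finset.card_eq_one]
        refine ⟨a, ?_⟩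
        ext q
        by_cases hq : q = a
        · subst hq
          simp [ha, hz.1, hz.2]
        · simp [Set.indicator_apply, hq]
      · refine le_trans ?_ hB
        have hsplit : (A ∪ (insert a B : Finset Q) : Set Q).indicator z = A.indicator z +
            ((insert a B : Finset Q) \ A : Set Q).indicator z := by
          funext q
          by_cases hq : q ∈ A
          · simp [hq]
          · simp [Set.indicator_apply, hq]
        rw [hsplit, ← Finset.card_insert_of_notMem ha]
        refine (energy_add_le _ _).trans (add_le_add hA
          (energy_le_mul_card_of_support hm fun q hq => ?_))
        exact (Set.mem_of_indicator_ne_zero hq).1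

/-- Sweeping `z` in the order of a key function `f`. -/
lemma barrier_le_of_sweep (hm : ∀ q, (Finset.univ.filter fun a => s a q ≠ 0).card ≤ m)
    {z : Pauli Q} (f : Q → ℕ) {e F : ℕ}
    (he : ∀ p, energy s (Set.indicator {q | f q < p} z) ≤ e)
    (hF : ∀ p, (Finset.univ.filter fun q => f q = p).card ≤ F) :
    barrier s z ≤ e + m * F := by
  have key : ∀ p, ReachableWithin s (e + m * F) (Set.indicator {q | f q < p} z) := by
    intro p
    induction p with
    | zero =>
      have h0 : Set.indicator {q | f q < 0} z = 0 := by
        funext q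
        simp
      rw [h0]
      exact reachableWithin_zero _
    | succ p ih =>
      have := ih.indicator_union hm (he p) (Finset.univ.filter fun q => f q = p)
        (by gcongr; exact hF p)
      convert this using 2
      ext q
      simp [le_iff_lt_or_eq]
  have hall := key (Finset.univ.sup f + 1)
  rw [Set.indicator_eq_self.2] at hall
  · exact barrier_le hall
  · intro q _
    exact Nat.lt_succ_of_le (Finset.le_sup (f := f) (Finset.mem_univ q))

lemma barrierMax_le {G : Submodule (ZMod 2) (Pauli Q)} {E : ℕ}
    (h : ∀ x ∈ dressed G, ∃ y ∈ G, barrier s (x + y) ≤ E) : barrierMax G s ≤ E := by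
  refine ciSup_le' fun x => ?_
  obtain ⟨y, hy, hE⟩ := h x x.2
  exact (ciInf_le' _ (⟨y, hy⟩ : G)).trans hE

lemma barrierMax_eq_zero {G : Submodule (ZMod 2) (Pauli Q)} (h : dressed G ≤ G) :
    barrierMax G s = 0 := by
  refine Nat.le_zero.1 (barrierMax_le fun x hx => ⟨-x, G.neg_mem (h hx), ?_⟩)
  rw [add_neg_cancel]
  exact barrier_le (reachableWithin_zero 0)

end Energy

/-! ### Neighbourhoods, cubes, walls and cells of the lattice. -/

section Lattice

variable {D L : ℕ}

/-- All coordinates of `q` and `q'` differ by less than `v`, up to multiples of `L`. -/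
def Near (v : ℕ) (q q' : Site D L) : Prop :=
  ∀ i, ∃ e : ℤ, |e| < v ∧ ((q' i : ℕ) : ℤ) ≡ (q i : ℕ) + e [ZMOD L]

lemma InCube.modEq {bc : Boundary} {w : ℕ} {c q : Site D L} (h : InCube bc w c q) (i : Fin D) :
    ∃ k < w, ((q i : ℕ) : ℤ) ≡ (c i : ℕ) + (k : ℕ) [ZMOD L] := by
  cases bc with
  | opened =>
    obtain ⟨k, hk, h⟩ := h i
    exact ⟨k, hk, by rw [h]; push_cast; rfl⟩
  | periodic =>
    obtain ⟨k, hk, h⟩ := h i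
    refine ⟨k, hk, ?_⟩
    rw [h]
    push_cast
    exact Int.mod_modEq _ _

lemma IsLocal.near {bc : Boundary} {v w : ℕ} (hw : w ≤ v) {x : Pauli (Site D L)}
    (hx : IsLocal bc w x) {q q' : Site D L} (hq : x q ≠ 0) (hq' : x q' ≠ 0) : Near v q q' := by
  obtain ⟨c, hc⟩ := hx
  intro i
  obtain ⟨k, hk, h⟩ := (hc q hq).modEq i
  obtain ⟨k', hk', h'⟩ := (hc q' hq').modEq i
  refine ⟨(k' : ℤ) - k, by rw [abs_lt]; omega, h'.trans ?_⟩
  have := (h.add_right ((k' : ℤ) - k)).symm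
  convert this using 1
  ring

/-- Neighbouring coordinates are close to each other, or close to the two ends of the lattice. -/
lemma Near.cases {v : ℕ} {q q' : Site D L} (h : Near v q q') (i : Fin D) :
    ((q i : ℕ) < q' i + v ∧ (q' i : ℕ) < q i + v) ∨ ((q i : ℕ) < v ∧ L < q' i + v) ∨
      ((q' i : ℕ) < v ∧ L < q i + v) := by
  obtain ⟨e, he, h⟩ := h i
  obtain ⟨t, ht⟩ := h.symm.dvd
  have h1 := (q i).2
  have h2 := (q' i).2
  rw [abs_lt] at he
  rcases lt_trichotomy t 0 with h0 | h0 | h0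
  · have : (L : ℤ) * t ≤ -L := by nlinarith
    omega
  · rw [h0, mul_zero] at ht
    omega
  · have : (L : ℤ) ≤ L * t := by nlinarith
    omega

lemma card_site_coord (A : Finset (Fin L)) (i : Fin D) :
    (Finset.univ.filter fun q : Site D L => q i ∈ A).card = A.card * L ^ (D - 1) := by
  classical
  have h : (Finset.univ.filter fun q : Site D L => q i ∈ A) =
      Fintype.piFinset (Function.update (fun _ => Finset.univ) i A) := by
    ext q
    simp only [Finset.mem_filter, Finset.mem_univ, true_and, Fintype.mem_piFinset]
    refine ⟨fun h j => ?_, fun h => by simpa using h i⟩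
    by_cases hj : j = i
    · subst hj; simpa using h
    · simp [hj]
  rw [h, Fintype.card_piFinset, ← Finset.mul_prod_erase _ _ (Finset.mem_univ i),
    Function.update_self, Finset.prod_congr rfl fun j hj => by
      rw [Function.update_of_ne (Finset.ne_of_mem_erase hj)], Finset.prod_const,
    Finset.card_erase_of_mem (Finset.mem_univ i)]
  simp

lemma card_site_coord_coord (A B : Finset (Fin L)) {i j : Fin D} (hij : i ≠ j) :
    (Finset.univ.filter fun q : Site D L => q i ∈ A ∧ q j ∈ B).card =
      A.card * B.card * L ^ (D - 2) := by
  classical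
  have h : (Finset.univ.filter fun q : Site D L => q i ∈ A ∧ q j ∈ B) =
      Fintype.piFinset (Function.update (Function.update (fun _ => Finset.univ) i A) j B) := by
    ext q
    simp only [Finset.mem_filter, Finset.mem_univ, true_and, Fintype.mem_piFinset]
    refine ⟨fun h k => ?_, fun h => ⟨by simpa [hij] using h i, by simpa using h j⟩⟩
    by_cases hj : k = j
    · subst hj; simpa using h.2
    · by_cases hi : k = i
      · subst hi; simpa [hj] using h.1
      · simp [hj, hi]
  have hi : i ∈ Finset.univ.erase j := by simp [hij]
  rw [h, Fintype.card_piFinset, ← Finset.mul_prod_erase _ _ (Finset.mem_univ j),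
    Function.update_self, ← Finset.mul_prod_erase _ _ hi, Function.update_of_ne hij,
    Function.update_self, Finset.prod_congr rfl fun k hk => by
      rw [Function.update_of_ne (Finset.ne_of_mem_erase (Finset.mem_of_mem_erase hk)),
        Function.update_of_ne (Finset.ne_of_mem_erase hk)], Finset.prod_const,
    Finset.card_erase_of_mem hi, Finset.card_erase_of_mem (Finset.mem_univ j)]
  simp only [Finset.card_univ, Fintype.card_fin, Nat.sub_sub]
  ring

lemma card_fin_le_of_val {A : Finset (Fin L)} {B : Finset ℕ} (h : ∀ n ∈ A, (n : ℕ) ∈ B) :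
    A.card ≤ B.card :=
  Finset.card_le_card_of_injOn (fun n : Fin L => (n : ℕ)) h Fin.val_injective.injOn

lemma card_fin_le_of_modEq {A : Finset (Fin L)} {E : Finset ℤ} (c : ℤ)
    (h : ∀ n ∈ A, ∃ e ∈ E, ((n : ℕ) : ℤ) ≡ c + e [ZMOD L]) : A.card ≤ E.card := by
  refine Finset.card_le_card_of_forall_subsingleton
    (fun (n : Fin L) e => ((n : ℕ) : ℤ) ≡ c + e [ZMOD L]) h fun e _ n hn n' hn' => ?_
  have h1 : ((n : ℕ) : ℤ) ≡ ((n' : ℕ) : ℤ) [ZMOD L] := hn.2.trans hn'.2.symm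
  exact Fin.ext (Nat.ModEq.eq_of_lt_of_lt (Int.natCast_modEq_iff.1 h1) n.2 n'.2)

/-- The cube with radius `r` and centre `c` in the periodic lattice. -/
def cube (L : ℕ) (c : Fin D → ℤ) (r : ℕ) : Set (Site D L) :=
  {q | ∀ i, ∃ e : ℤ, |e| < r ∧ ((q i : ℕ) : ℤ) ≡ c i + e [ZMOD L]}

lemma cube_mono (c : Fin D → ℤ) {r r' : ℕ} (h : r ≤ r') : cube L c r ⊆ cube L c r' :=
  fun _ hq i => let ⟨e, he, h'⟩ := hq i
    ⟨e, he.trans_le (by exact_mod_cast h), h'⟩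

lemma mem_cube_of_near {c : Fin D → ℤ} {r v : ℕ} {q q' : Site D L}
    (hq : q ∈ cube L c r) (h : Near v q q') : q' ∈ cube L c (r + v) := fun i => by
  obtain ⟨e, he, h1⟩ := hq i
  obtain ⟨e', he', h2⟩ := h i
  refine ⟨e + e', (abs_add_le _ _).trans_lt (by push_cast; linarith), h2.trans ?_⟩
  rw [← add_assoc]
  exact h1.add_right e'

/-- In a shell, some coordinate has all its offsets below `r + v` at least `r` in absolute value,
leaving `2 * v` residues; the others have at most `2 * (r + v)`. Wrapping around only lowers the
count. -/
lemma exists_card_cube_diff_le (c : Fin D → ℤ) (r v : ℕ) :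
    ∃ A : Finset (Site D L), cube L c (r + v) \ cube L c r ⊆ A ∧
      A.card ≤ D * (2 * v * (2 * (r + v)) ^ (D - 1)) := by
  classical
  set I : Fin D → Finset (Fin L) := fun i =>
    Finset.univ.filter fun n => ∃ e : ℤ, |e| < (r + v : ℕ) ∧ ((n : ℕ) : ℤ) ≡ c i + e [ZMOD L]
  set J : Fin D → Finset (Fin L) := fun i =>
    Finset.univ.filter fun n => ∃ e : ℤ, (|e| < (r + v : ℕ) ∧ ¬ |e| < r) ∧
      ((n : ℕ) : ℤ) ≡ c i + e [ZMOD L]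
  have hI : ∀ i, (I i).card ≤ 2 * (r + v) := fun i => by
    refine (card_fin_le_of_modEq (E := Finset.Ioo (-(r + v : ℕ) : ℤ) (r + v : ℕ)) (c i)
      fun n hn => ?_).trans ?_
    · obtain ⟨e, he, h⟩ := (Finset.mem_filter.1 hn).2
      exact ⟨e, by rwa [Finset.mem_Ioo, ← abs_lt], h⟩
    · rw [Int.card_Ioo]
      omega
  have hJ : ∀ i, (J i).card ≤ 2 * v := fun i => by
    refine (card_fin_le_of_modEq (E := Finset.Ico (r : ℤ) (r + v) ∪ Finset.Ioc (-(r + v) : ℤ) (-r))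
      (c i) fun n hn => ?_).trans ?_
    · obtain ⟨e, ⟨he, he'⟩, h⟩ := (Finset.mem_filter.1 hn).2
      refine ⟨e, ?_, h⟩
      rw [Finset.mem_union, Finset.mem_Ico, Finset.mem_Ioc]
      rw [abs_lt] at he he'
      omega
    · refine (Finset.card_union_le _ _).trans ?_
      rw [Int.card_Ico, Int.card_Ioc]
      omega
  refine ⟨Finset.univ.biUnion fun i => Fintype.piFinset (Function.update I i (J i)), ?_, ?_⟩
  · rintro q ⟨hq, hq'⟩
    obtain ⟨i, hi⟩ := not_forall.1 hq'
    simp only [Finset.coe_biUnion, Set.mem_iUnion, Finset.mem_coe, Fintype.mem_piFinset]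
    refine ⟨i, Finset.mem_univ i, fun j => ?_⟩
    by_cases hj : j = i
    · subst hj
      obtain ⟨e, he, h⟩ := hq j
      rw [Function.update_self]
      exact Finset.mem_filter.2 ⟨Finset.mem_univ _, e, ⟨he, fun h' => hi ⟨e, h', h⟩⟩, h⟩
    · rw [Function.update_of_ne hj]
      exact Finset.mem_filter.2 ⟨Finset.mem_univ _, hq j⟩
  · refine (Finset.card_biUnion_le_card_mul _ _ (2 * v * (2 * (r + v)) ^ (D - 1))
      fun i _ => ?_).trans (by simp)
    rw [Fintype.card_piFinset, ← Finset.mul_prod_erase _ _ (Finset.mem_univ i),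
      Function.update_self]
    refine Nat.mul_le_mul (hJ i) ?_
    refine (Finset.prod_le_pow_card _ _ (2 * (r + v)) fun j hj => ?_).trans ?_
    · rw [Function.update_of_ne (Finset.ne_of_mem_erase hj)]
      exact hI j
    · rw [Finset.card_erase_of_mem (Finset.mem_univ i)]
      simp

/-- The walls that separate the cells, intervals with lengths between `R - v` and `2 * R`, of a
one-dimensional lattice: intervals with length `v`. -/
def IsWall (L R v n : ℕ) : Prop := n % R < v ∧ n / R < L / R

/-- The sites outside the walls in all directions. -/
def cells (D L R v : ℕ) : Set (Site D L) := {q | ∀ i, ¬ IsWall L R v (q i)}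

/-- The index of the cell that contains `n`. -/
def cellIndex (L R n : ℕ) : ℕ := min (n / R) (L / R - 1)

lemma cellIndex_mul_le (L R n : ℕ) : cellIndex L R n * R ≤ n :=
  (Nat.mul_le_mul_right R (min_le_left _ _)).trans (Nat.div_mul_le_self n R)

lemma lt_cellIndex_mul_add {R n : ℕ} (hR : 0 < R) (hRL : R ≤ L) (hn : n < L) :
    n < cellIndex L R n * R + 2 * R := by
  have h1 : 1 ≤ L / R := (Nat.one_le_div_iff hR).2 hRL
  have h2 := Nat.lt_div_mul_add hR (a := n)
  have h3 := Nat.lt_div_mul_add hR (a := L)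
  unfold cellIndex
  rcases le_total (n / R) (L / R - 1) with h | h
  · rw [min_eq_left h]
    omega
  · rw [min_eq_right h, Nat.sub_mul]
    have : R ≤ L / R * R := Nat.le_mul_of_pos_left R h1
    omega

/-- A step shorter than `v` cannot jump over a wall. -/
lemma cellIndex_le_of_lt_add {R v n n' : ℕ} (hR : 0 < R) (hv : v ≤ R) (hn' : ¬ IsWall L R v n')
    (h : n' < n + v) : cellIndex L R n' ≤ cellIndex L R n := by
  by_contra hc
  unfold cellIndex at hc
  unfold IsWall at hn'
  have h3 : n < (n / R + 1) * R := Nat.lt_mul_of_div_lt (Nat.lt_succ_self _) hR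
  have h4 := Nat.div_add_mod' n' R
  generalize n / R = a at *
  generalize n' / R = b at *
  generalize L / R = l at *
  generalize n' % R = u at *
  have h1 : a < b := by omega
  have h5 : (a + 1) * R ≤ b * R := Nat.mul_le_mul_right R h1
  -- The residue of `n'` is below `v`, so `n'` avoids the walls only in the trailing incomplete
  -- block, which `cellIndex` merges into the last cell.
  have h7 : l ≤ b := not_lt.1 fun h => hn' ⟨by omega, h⟩
  have h8 : (a + 1 + 1) * R ≤ b * R := Nat.mul_le_mul_right R (by omega)
  rw [Nat.succ_mul (a + 1)] at h8
  omega

/-- Neighbouring sites outside the walls are in the same cell. -/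
lemma cellIndex_eq_of_near {R v : ℕ} (hR : 0 < R) (hRL : R ≤ L) (hv : v ≤ R) {q q' : Site D L}
    (hq : q ∈ cells D L R v) (hq' : q' ∈ cells D L R v) (h : Near v q q') (i : Fin D) :
    cellIndex L R (q i) = cellIndex L R (q' i) := by
  have hwall : ∀ n, n < v → IsWall L R v n := fun n hn =>
    ⟨(Nat.mod_le _ _).trans_lt hn, by
      rw [Nat.div_eq_of_lt (hn.trans_le hv)]
      exact Nat.div_pos hRL hR⟩
  rcases h.cases i with h | h | h
  · exact le_antisymm (cellIndex_le_of_lt_add hR hv (hq i) h.1)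
      (cellIndex_le_of_lt_add hR hv (hq' i) h.2)
  · exact absurd (hwall _ h.1) (hq i)
  · exact absurd (hwall _ h.1) (hq' i)

lemma card_wall_le {R v : ℕ} (A : Finset (Fin L)) (hA : ∀ n ∈ A, IsWall L R v n) :
    A.card ≤ v * (L / R) := by
  have := Finset.card_le_card_of_injOn (s := A) (t := Finset.range v ×ˢ Finset.range (L / R))
    (fun n : Fin L => ((n : ℕ) % R, (n : ℕ) / R)) (fun n hn => by
      simpa [IsWall] using hA n hn) (fun n _ n' _ h => by
      rw [Prod.mk.injEq] at h
      rw [Fin.ext_iff, ← Nat.div_add_mod' n R, ← Nat.div_add_mod' n' R, h.1, h.2])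
  simpa using this

/-- The position of `n`, with all sites of a wall moved to the beginning of the wall. -/
def wallStart (L R v n : ℕ) : ℕ := open Classical in if IsWall L R v n then n - n % R else n

lemma wallStart_le (L R v n : ℕ) : wallStart L R v n ≤ n := by
  unfold wallStart
  split_ifs <;> omega

lemma lt_wallStart_add {v : ℕ} (hv : 0 < v) (L R n : ℕ) : n < wallStart L R v n + v := by
  unfold wallStart
  split_ifs with h
  · have := h.1
    omega
  · omega

lemma wallStart_eq_div_mul {R v n : ℕ} (h : IsWall L R v n) : wallStart L R v n = n / R * R := by
  unfold wallStart
  rw [if_pos h]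
  have := Nat.div_add_mod' n R
  omega

/-- Distinct walls are separated by gaps of length `R - v ≥ v`. -/
lemma wallStart_le_of_isWall {R v n n' : ℕ} (hv : 2 * v ≤ R) (hn : IsWall L R v n)
    (hn' : IsWall L R v n') (h : n < n' + v) : wallStart L R v n ≤ wallStart L R v n' := by
  rw [wallStart_eq_div_mul hn, wallStart_eq_div_mul hn']
  refine Nat.mul_le_mul_right R (not_lt.1 fun hlt => ?_)
  have h1 := Nat.div_add_mod' n R
  have h2 := Nat.div_add_mod' n' R
  have h3 := hn'.1
  have h4 := Nat.mul_le_mul_right R (Nat.succ_le_of_lt hlt)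
  rw [Nat.succ_mul] at h4
  omega

/-- Walls open complete blocks only, so each is followed by a gap before the upper end. This
excludes neighbours in two walls across the periodic boundary. -/
lemma add_le_of_isWall {R v n : ℕ} (hv : 2 * v ≤ R) (hn : IsWall L R v n) : n + v ≤ L := by
  have h1 := Nat.div_add_mod' n R
  have h2 := Nat.div_add_mod' L R
  have h3 := Nat.mul_le_mul_right R (Nat.succ_le_of_lt hn.2)
  have h4 := hn.1
  rw [Nat.succ_mul] at h3
  omega

end Lattice

/-! ### Cleaning the cells and sweeping the walls. -/

section Lattice

variable {D L N : ℕ} {G : Submodule (ZMod 2) (Pauli (Site D L))} {s : Fin N → Pauli (Site D L)}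
  {T : Set (Pauli (Site D L))} {m R v : ℕ}

/-- If the shells of all cubes with radius of order `R` are smaller than the distance, then the
cells support no nontrivial bare logical operators. -/
lemma mem_of_cells_of_lt_distance (hT : Submodule.span (ZMod 2) T = G)
    (hs : Submodule.span (ZMod 2) (Set.range s) = stabilizer G)
    (hTn : ∀ t ∈ T, ∀ q q', t q ≠ 0 → t q' ≠ 0 → Near v q q')
    (hsn : ∀ a q q', s a q ≠ 0 → s a q' ≠ 0 → Near v q q')
    (hD : 0 < D) (hv : 0 < v) (hvR : v ≤ R) (hRL : R ≤ L)
    (hd : ((D * (2 * v) * (6 * v) ^ (D - 1) * R ^ (D - 1) : ℕ) : ℕ∞) < distance G)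
    {x : Pauli (Site D L)} (hx : x ∈ perp G) (hxM : ∀ q, q ∉ cells D L R v → x q = 0) :
    x ∈ G := by
  have hR : 0 < R := hv.trans_le hvR
  refine mem_of_cells hT (fun q i => cellIndex L R (q i)) (fun t ht q hq q' hq' htq htq' =>
    funext fun i => cellIndex_eq_of_near hR hRL hvR hq hq' (hTn t ht q q' htq htq') i)
    (fun j y hy hyj => ?_) hx hxM
  -- The cubes are centred at the lower corner of the cell. Since cells are shorter than `2 * R` and
  -- `v ≥ 1`, radius `2 * R * v` covers the cell.
  refine mem_of_shells hT hs (Near v) hTn hsn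
    (K := fun i => cube L (fun k => ((j k * R : ℕ) : ℤ)) (i * v)) (n := 2 * R) ?_ ?_ ?_ ?_
    (2 * R) le_rfl y hy fun q hq => hyj q fun hqj => hq ?_
  · refine Set.eq_empty_of_forall_notMem fun q hq => ?_
    obtain ⟨e, he, _⟩ := hq ⟨0, hD⟩
    rw [zero_mul] at he
    exact absurd he (not_lt.2 (abs_nonneg e))
  · intro i
    exact cube_mono _ (Nat.mul_le_mul_right v (Nat.le_succ i))
  · intro i q q' hq h
    rw [Nat.succ_mul]
    exact mem_cube_of_near hq h
  · intro i hi x hx hxK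
    obtain ⟨A, hA, hcard⟩ := exists_card_cube_diff_le (L := L) (fun k => ((j k * R : ℕ) : ℤ))
      (i * v) v
    rw [← Nat.succ_mul] at hA
    refine mem_of_card_lt_distance hx A (fun q hq => hxK q fun h => hq (hA h))
      (lt_of_le_of_lt (Nat.cast_le.2 (hcard.trans ?_)) hd)
    -- From `i ≤ 2 * R` and `R ≥ 1`; doubling the radius gives the side `6 * v * R` in `hd`.
    have h1 : (i + 1) * v ≤ 3 * R * v := Nat.mul_le_mul_right v (by omega)
    rw [mul_assoc (D * (2 * v)), ← mul_pow, mul_assoc D]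
    refine Nat.mul_le_mul_left _ (Nat.mul_le_mul_left _ (Nat.pow_le_pow_left ?_ _))
    linarith
  · intro k
    obtain ⟨_, hj⟩ := hqj
    have h1 := congrFun hj k
    have h2 := cellIndex_mul_le L R (q k)
    have h3 := lt_cellIndex_mul_add hR hRL (q k).2
    rw [h1] at h2 h3
    have h4 : 2 * R ≤ 2 * R * v := Nat.le_mul_of_pos_right _ hv
    refine ⟨(q k : ℕ) - (j k * R : ℕ), ?_, by rw [add_sub_cancel]⟩
    rw [abs_lt]
    omega

/-- The dressed logical operators can be supported on the walls. -/
lemma exists_add_trivialOn_cells (hT : Submodule.span (ZMod 2) T = G)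
    (hs : Submodule.span (ZMod 2) (Set.range s) = stabilizer G)
    (hTn : ∀ t ∈ T, ∀ q q', t q ≠ 0 → t q' ≠ 0 → Near v q q')
    (hsn : ∀ a q q', s a q ≠ 0 → s a q' ≠ 0 → Near v q q')
    (hD : 0 < D) (hv : 0 < v) (hvR : v ≤ R) (hRL : R ≤ L)
    (hd : ((D * (2 * v) * (6 * v) ^ (D - 1) * R ^ (D - 1) : ℕ) : ℕ∞) < distance G)
    {x : Pauli (Site D L)} (hx : x ∈ dressed G) :
    ∃ g ∈ G, ∀ q ∈ cells D L R v, (x + g) q = 0 :=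
  -- Cleaning with `U = G`: bare operators on the cells are in `G`, hence in `G ∩ G^⊥`.
  exists_add_trivialOn (V := stabilizer G) (fun _ hy hyM =>
    ⟨mem_of_cells_of_lt_distance hT hs hTn hsn hD hv hvR hRL hd hy hyM, hy⟩) hx

lemma exists_isWall_of_ne_zero {z : Pauli (Site D L)} (hz : ∀ q ∈ cells D L R v, z q = 0)
    {q : Site D L} (hq : z q ≠ 0) : ∃ i, IsWall L R v (q i) := by
  by_contra h
  push Not at h
  exact hq (hz q h)

/-- A code with distance larger than a constant times `L ^ (D - 1)` encodes nothing. -/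
lemma dressed_le_of_lt_distance (hT : Submodule.span (ZMod 2) T = G)
    (hs : Submodule.span (ZMod 2) (Set.range s) = stabilizer G)
    (hTn : ∀ t ∈ T, ∀ q q', t q ≠ 0 → t q' ≠ 0 → Near v q q')
    (hsn : ∀ a q q', s a q ≠ 0 → s a q' ≠ 0 → Near v q q')
    (hD : 0 < D) (hv : 0 < v)
    (hd : ((D * (2 * v) * (6 * v) ^ (D - 1) * L ^ (D - 1) : ℕ) : ℕ∞) < distance G) :
    dressed G ≤ G := by
  classical
  intro x hx
  have h1 : 1 ≤ (6 * v) ^ (D - 1) := Nat.one_le_pow _ _ (by omega)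
  rcases lt_or_ge L v with hL | hL
  · refine mem_of_card_lt_distance hx Finset.univ (fun q hq => absurd (Finset.mem_univ q) hq)
      (lt_of_le_of_lt (Nat.cast_le.2 ?_) hd)
    rw [Finset.card_univ, Fintype.card_fun, Fintype.card_fin, Fintype.card_fin]
    obtain ⟨k, rfl⟩ : ∃ k, D = k + 1 := ⟨D - 1, by omega⟩
    rw [pow_succ', Nat.add_sub_cancel]
    rw [Nat.add_sub_cancel] at h1
    refine Nat.mul_le_mul_right _ ?_
    calc L ≤ 1 * (2 * v) * 1 := by omega
      _ ≤ _ := by gcongr; omega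
  -- With `R = L` there is one wall per direction, and all walls together have fewer sites than the
  -- distance.
  · obtain ⟨g, hg, hz⟩ := exists_add_trivialOn_cells hT hs hTn hsn hD hv hL le_rfl hd hx
    refine (G.add_mem_iff_left hg).1 (mem_of_card_lt_distance
      ((dressed G).add_mem hx (le_dressed G hg))
      (Finset.univ.biUnion fun i => Finset.univ.filter fun q =>
        q i ∈ Finset.univ.filter fun n : Fin L => IsWall L L v n) (fun q hq => ?_)
      (lt_of_le_of_lt (Nat.cast_le.2 ?_) hd))
    · by_contra hne
      obtain ⟨i, hi⟩ := exists_isWall_of_ne_zero hz hne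
      exact hq (by simpa using ⟨i, hi⟩)
    · refine (Finset.card_biUnion_le_card_mul _ _ (2 * v * L ^ (D - 1)) fun i _ => ?_).trans ?_
      · rw [card_site_coord]
        refine Nat.mul_le_mul_right _ ((card_wall_le _ fun n hn =>
          (Finset.mem_filter.1 hn).2).trans ?_)
        rw [Nat.div_self (hv.trans_le hL)]
        omega
      · rw [Finset.card_univ, Fintype.card_fin, ← mul_assoc]
        exact Nat.mul_le_mul_right _ (Nat.le_mul_of_pos_right _ h1)

/-- The energy barrier for sweeping with a hyperplane. -/
lemma barrier_le_hyperplane (hm : ∀ q, (Finset.univ.filter fun a => s a q ≠ 0).card ≤ m)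
    (hsn : ∀ a q q', s a q ≠ 0 → s a q' ≠ 0 → Near v q q')
    (hD : 0 < D) {z : Pauli (Site D L)} (hz : ∀ a, symp z (s a) = 0) :
    barrier s z ≤ m * (2 * v + 1) * L ^ (D - 1) := by
  classical
  let i₀ : Fin D := ⟨0, hD⟩
  refine (barrier_le_of_sweep hm (fun q => (q i₀ : ℕ)) (e := m * (2 * v * L ^ (D - 1)))
    (F := L ^ (D - 1)) (fun p => ?_) fun p => ?_).trans (by apply le_of_eq; ring)
  -- The layers just behind the front, and those at the lower end, which can neighbour the unswept
  -- side through the boundary.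
  · refine (energy_indicator_le hm hsn hz (B := Finset.univ.filter fun q => q i₀ ∈
      Finset.univ.filter fun n : Fin L => (n : ℕ) ∈ Finset.range v ∪ Finset.Ico (p - v) p)
      fun q hq q' hq' _ _ h => Or.inl ?_).trans ?_
    · simp only [Finset.mem_filter, Finset.mem_univ, true_and, Finset.mem_union, Finset.mem_range,
        Finset.mem_Ico]
      simp only [Set.mem_ofPred_eq, not_lt] at hq hq'
      have := h.cases i₀
      omega
    · rw [card_site_coord]
      gcongr
      refine (card_fin_le_of_val fun n hn => (Finset.mem_filter.1 hn).2).trans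
        ((Finset.card_union_le _ _).trans ?_)
      rw [Finset.card_range, Nat.card_Ico]
      omega
  · have : (Finset.univ.filter fun q : Site D L => (q i₀ : ℕ) = p) = Finset.univ.filter fun q =>
        q i₀ ∈ Finset.univ.filter fun n : Fin L => (n : ℕ) = p := by simp
    rw [this, card_site_coord]
    refine (Nat.mul_le_mul_right _ (card_fin_le_of_val (B := {p})
      fun n hn => ?_)).trans_eq (by simp)
    simpa using hn

lemma lex_cases {a a' b b' p : ℕ} (hb' : b' < L) (h : L * a + b < p)
    (h' : ¬ L * a' + b' < p) :
    a ≤ p / L ∧ p / L ≤ a' ∧ (a = a' → a = p / L ∧ b < p % L ∧ p % L ≤ b') := by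
  have hp := Nat.div_add_mod p L
  have hpL := Nat.mod_lt p (by omega : L > 0)
  generalize p / L = p₀ at *
  generalize p % L = p₁ at *
  have h1 : a ≤ p₀ := by
    by_contra hc
    have := Nat.mul_le_mul_left L (Nat.succ_le_of_lt (not_le.1 hc))
    rw [Nat.mul_succ] at this
    omega
  have h2 : p₀ ≤ a' := by
    by_contra hc
    have := Nat.mul_le_mul_left L (Nat.succ_le_of_lt (not_le.1 hc))
    rw [Nat.mul_succ] at this
    omega
  refine ⟨h1, h2, fun haa => ?_⟩
  obtain rfl : a = p₀ := by omega
  subst haa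
  omega

/-- The energy barrier for sweeping an operator supported on the walls: the walls orthogonal to one
direction are built column by column, and the other walls layer by layer. -/
lemma barrier_le_walls (hm : ∀ q, (Finset.univ.filter fun a => s a q ≠ 0).card ≤ m)
    (hsn : ∀ a q q', s a q ≠ 0 → s a q' ≠ 0 → Near v q q')
    (hD : 2 ≤ D) (hv : 0 < v) (hvR : 2 * v ≤ R) (hRL : R ≤ L)
    {z : Pauli (Site D L)} (hz : ∀ a, symp z (s a) = 0) (hzM : ∀ q ∈ cells D L R v, z q = 0) :
    barrier s z ≤ m * (8 * D * v ^ 2) * (L / R) * L ^ (D - 2) := by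
  classical
  let i₀ : Fin D := ⟨0, by omega⟩
  let i₁ : Fin D := ⟨1, by omega⟩
  have hi : i₀ ≠ i₁ := by simp [i₀, i₁]
  have hLR : 1 ≤ L / R := (Nat.one_le_div_iff (by omega)).2 hRL
  let A₀ : ℕ → Finset (Fin L) := fun p => Finset.univ.filter fun n => wallStart L R v n = p
  have hA₀ : ∀ p, (A₀ p).card ≤ v := fun p => by
    refine (card_fin_le_of_val (B := Finset.Ico p (p + v)) fun n hn => ?_).trans (by simp)
    have h := (Finset.mem_filter.1 hn).2
    have h1 := wallStart_le L R v n
    have h2 := lt_wallStart_add hv L R n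
    rw [Finset.mem_Ico]
    omega
  -- A lexicographic key: `wallStart` collapses each wall orthogonal to `i₀` to a single layer, and
  -- `i₁` orders the columns within a layer.
  refine (barrier_le_of_sweep hm (fun q => L * wallStart L R v (q i₀) + (q i₁ : ℕ))
    (e := m * (v * (2 * v) * L ^ (D - 2) + D * (5 * v * (v * (L / R)) * L ^ (D - 2))))
    (F := v * 1 * L ^ (D - 2)) (fun p => ?_) fun p => ?_).trans ?_
  · let A₁ : Finset (Fin L) := Finset.univ.filter fun n =>
      (n : ℕ) ∈ Finset.range v ∪ Finset.Ico (p % L - v) (p % L)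
    let Z : Finset (Fin L) := Finset.univ.filter fun n =>
      (n : ℕ) ∈ Finset.Ico (p / L - v) (p / L + 2 * v) ∪ (Finset.range v ∪ Finset.Ico (L - v) L)
    let W : Finset (Fin L) := Finset.univ.filter fun n => IsWall L R v n
    -- First the column front inside the current layer, then the transversal walls within the slab
    -- `Z` around the layer front and both ends.
    let B : Finset (Site D L) := (Finset.univ.filter fun q => q i₀ ∈ A₀ (p / L) ∧ q i₁ ∈ A₁) ∪
      (Finset.univ.erase i₀).biUnion fun i => Finset.univ.filter fun q => q i₀ ∈ Z ∧ q i ∈ W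
    have hZ : ∀ r : Site D L, z r ≠ 0 → ¬ IsWall L R v (r i₀) → r i₀ ∈ Z → r ∈ B := by
      intro r hr hw hrZ
      obtain ⟨i, hiw⟩ := exists_isWall_of_ne_zero hzM hr
      refine Finset.mem_union_right _ (Finset.mem_biUnion.2 ⟨i, ?_, ?_⟩)
      · refine Finset.mem_erase.2 ⟨?_, Finset.mem_univ i⟩
        rintro rfl
        exact hw hiw
      · exact Finset.mem_filter.2 ⟨Finset.mem_univ r, hrZ,
          Finset.mem_filter.2 ⟨Finset.mem_univ _, hiw⟩⟩
    refine (energy_indicator_le hm hsn hz (B := B) fun q hq q' hq' hzq hzq' h => ?_).trans ?_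
    · obtain ⟨h1, h2, h3⟩ := lex_cases (q' i₁).2 hq hq'
      by_cases hb : wallStart L R v (q i₀) = wallStart L R v (q' i₀)
      · left
        obtain ⟨h4, h5, h6⟩ := h3 hb
        refine Finset.mem_union_left _ (Finset.mem_filter.2 ⟨Finset.mem_univ q,
          Finset.mem_filter.2 ⟨Finset.mem_univ _, h4⟩,
          Finset.mem_filter.2 ⟨Finset.mem_univ _, ?_⟩⟩)
        have := h.cases i₁
        simp only [Finset.mem_union, Finset.mem_range, Finset.mem_Ico]
        omega
      · have hc := h.cases i₀
        have h4 := wallStart_le L R v (q i₀)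
        have h5 := lt_wallStart_add hv L R (q i₀)
        have h6 := wallStart_le L R v (q' i₀)
        have h7 := lt_wallStart_add hv L R (q' i₀)
        have h8 := (q i₀).2
        have h9 := (q' i₀).2
        have hqZ : q i₀ ∈ Z := by
          refine Finset.mem_filter.2 ⟨Finset.mem_univ _, ?_⟩
          simp only [Finset.mem_union, Finset.mem_range, Finset.mem_Ico]
          omega
        have hqZ' : q' i₀ ∈ Z := by
          refine Finset.mem_filter.2 ⟨Finset.mem_univ _, ?_⟩
          simp only [Finset.mem_union, Finset.mem_range, Finset.mem_Ico]
          omega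
        by_cases hw : IsWall L R v (q i₀)
        · by_cases hw' : IsWall L R v (q' i₀)
          -- Neighbours that both lie in walls orthogonal to `i₀` share a wall, so their layers
          -- would coincide.
          · exfalso
            rcases hc with hc | hc | hc
            · exact hb (le_antisymm (wallStart_le_of_isWall hvR hw hw' hc.1)
                (wallStart_le_of_isWall hvR hw' hw hc.2))
            · have := add_le_of_isWall hvR hw'
              omega
            · have := add_le_of_isWall hvR hw
              omega
          · exact Or.inr (hZ q' hzq' hw' hqZ')
        · exact Or.inl (hZ q hzq hw hqZ)
    · have hA₁ : A₁.card ≤ 2 * v := by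
        refine (card_fin_le_of_val fun n hn => (Finset.mem_filter.1 hn).2).trans
          ((Finset.card_union_le _ _).trans ?_)
        rw [Finset.card_range, Nat.card_Ico]
        omega
      have hZcard : Z.card ≤ 5 * v := by
        refine (card_fin_le_of_val fun n hn => (Finset.mem_filter.1 hn).2).trans
          ((Finset.card_union_le _ _).trans ((Nat.add_le_add_left
            (Finset.card_union_le _ _) _).trans ?_))
        rw [Finset.card_range, Nat.card_Ico, Nat.card_Ico]
        omega
      have hW : W.card ≤ v * (L / R) := card_wall_le _ fun n hn => (Finset.mem_filter.1 hn).2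
      refine Nat.mul_le_mul_left m ((Finset.card_union_le _ _).trans (Nat.add_le_add ?_ ?_))
      · rw [card_site_coord_coord _ _ hi]
        exact Nat.mul_le_mul_right _ (Nat.mul_le_mul (hA₀ _) hA₁)
      · refine (Finset.card_biUnion_le_card_mul _ _ (5 * v * (v * (L / R)) * L ^ (D - 2))
          fun i hi' => ?_).trans (Nat.mul_le_mul_right _ ?_)
        · rw [card_site_coord_coord _ _ (Finset.ne_of_mem_erase hi').symm]
          exact Nat.mul_le_mul_right _ (Nat.mul_le_mul hZcard hW)
        · exact (Finset.card_le_univ _).trans (by simp)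
  · have hsub : (Finset.univ.filter fun q : Site D L =>
        L * wallStart L R v (q i₀) + (q i₁ : ℕ) = p) ⊆ Finset.univ.filter fun q =>
        q i₀ ∈ A₀ (p / L) ∧ q i₁ ∈ Finset.univ.filter fun n : Fin L => (n : ℕ) = p % L := by
      intro q hq
      have h1 := (Finset.mem_filter.1 hq).2
      have h2 := (q i₁).2
      simp only [A₀, Finset.mem_filter, Finset.mem_univ, true_and]
      rw [← h1, Nat.mul_add_div (by omega), Nat.mul_add_mod, Nat.div_eq_of_lt h2,
        Nat.mod_eq_of_lt h2]
      simp
    refine (Finset.card_le_card hsub).trans ?_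
    rw [card_site_coord_coord _ _ hi]
    refine Nat.mul_le_mul_right _ (Nat.mul_le_mul (hA₀ _) (card_fin_le_of_val (B := {p % L})
      fun n hn => ?_))
    simpa using hn
  · have h1 : v * (2 * v) + D * (5 * v * (v * (L / R))) + v * 1 ≤ 8 * D * v ^ 2 * (L / R) := by
      have h2 : v ≤ v ^ 2 := Nat.le_self_pow two_ne_zero v
      have h3 : v ^ 2 ≤ D * v ^ 2 * (L / R) := by
        calc v ^ 2 = 1 * v ^ 2 * 1 := by ring
          _ ≤ _ := by gcongr; omega
      calc _ = 2 * v ^ 2 + 5 * (D * v ^ 2 * (L / R)) + v := by ring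
        _ ≤ 8 * (D * v ^ 2 * (L / R)) := by omega
        _ = _ := by ring
    calc _ = m * (v * (2 * v) + D * (5 * v * (v * (L / R))) + v * 1) * L ^ (D - 2) := by ring
      _ ≤ m * (8 * D * v ^ 2 * (L / R)) * L ^ (D - 2) := by gcongr
      _ = _ := by ring

end Lattice

/-! ### Choice of the wall spacing and the asymptotic bounds. -/

lemma natCast_lt_distance {Q : Type} [Fintype Q] {G : Submodule (ZMod 2) (Pauli Q)} {r : ℝ}
    (h : ENNReal.ofReal r ≤ ((distance G : ℕ∞) : ℝ≥0∞)) {n : ℕ} (hn : (n : ℝ) < r) :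
    (n : ℕ∞) < distance G := by
  by_contra hc
  have h1 : ((distance G : ℕ∞) : ℝ≥0∞) ≤ ((n : ℕ∞) : ℝ≥0∞) := ENat.toENNReal_le.2 (not_lt.1 hc)
  have h2 := h.trans h1
  rw [ENat.toENNReal_coe, ENNReal.ofReal_le_natCast] at h2
  · exact absurd hn (not_lt.2 h2)

/-- The bounds on the energy barrier in terms of the distance, for a code on a finite lattice. -/
lemma barrierMax_bounds {D L N w wS m : ℕ} {bc : Boundary}
    {G : Submodule (ZMod 2) (Pauli (Site D L))} {s : Fin N → Pauli (Site D L)}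
    (hD : 2 ≤ D) (hG : HasLocalGenerators bc w G) (hs : IsLocalStabilizerFamily bc wS m G s)
    {v : ℕ} (hv : 0 < v) (hw : w ≤ v) (hwS : wS ≤ v) :
    barrierMax G s ≤ m * (2 * v + 1) * L ^ (D - 1) ∧
    (((D * (2 * v) * (6 * v) ^ (D - 1) * L ^ (D - 1) : ℕ) : ℕ∞) < distance G →
      barrierMax G s = 0) ∧
    ∀ R, 2 * v ≤ R → R ≤ L →
      ((D * (2 * v) * (6 * v) ^ (D - 1) * R ^ (D - 1) : ℕ) : ℕ∞) < distance G →
      barrierMax G s ≤ m * (8 * D * v ^ 2) * (L / R) * L ^ (D - 2) := by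
  obtain ⟨T, hT, hTl⟩ := hG
  have hTn : ∀ t ∈ T, ∀ q q', t q ≠ 0 → t q' ≠ 0 → Near v q q' := fun t ht _ _ hq hq' =>
    (hTl t ht).near hw hq hq'
  have hsn : ∀ a q q', s a q ≠ 0 → s a q' ≠ 0 → Near v q q' := fun a _ _ hq hq' =>
    (hs.isLocal a).near hwS hq hq'
  have hz : ∀ z ∈ dressed G, ∀ a, symp z (s a) = 0 := fun z hz a => by
    refine hz _ ?_
    rw [← hs.span_eq]
    exact Submodule.subset_span ⟨a, rfl⟩
  refine ⟨barrierMax_le fun x hx => ⟨0, G.zero_mem, ?_⟩, fun h => barrierMax_eq_zero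
    (dressed_le_of_lt_distance hT hs.span_eq hTn hsn (by omega) hv h),
    fun R hvR hRL h => barrierMax_le fun x hx => ?_⟩
  · rw [add_zero]
    exact barrier_le_hyperplane hs.card_le hsn (by omega) (hz x hx)
  · obtain ⟨g, hg, hgz⟩ := exists_add_trivialOn_cells hT hs.span_eq hTn hsn (by omega) hv
      (by omega) hRL h hx
    exact ⟨g, hg, barrier_le_walls hs.card_le hsn hD hv hvR hRL
      (hz _ ((dressed G).add_mem hx (le_dressed G hg))) hgz⟩

/-- The tradeoff between distance and energy barrier. -/
lemma exists_barrierMax_le {D : ℕ} (hD : 2 ≤ D) (w wS m : ℕ) {c : ℝ} (α : ℝ) (hc : 0 < c) :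
    ∃ C : ℝ, ∀ (L : ℕ), 0 < L → ∀ (bc : Boundary)
      (G : Submodule (ZMod 2) (Pauli (Site D L))) (N : ℕ) (s : Fin N → Pauli (Site D L)),
      HasLocalGenerators bc w G →
      IsLocalStabilizerFamily bc wS m G s →
      ENNReal.ofReal (c * (L : ℝ) ^ α) ≤ ((distance G : ℕ∞) : ℝ≥0∞) →
      (barrierMax G s : ℝ) ≤ C * (L : ℝ) ^ ((D : ℝ) - 1 - α / ((D : ℝ) - 1)) := by
  obtain ⟨v, hv, hw, hwS⟩ : ∃ v : ℕ, 0 < v ∧ w ≤ v ∧ wS ≤ v :=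
    ⟨max w wS + 1, by omega, by omega, by omega⟩
  obtain ⟨k, rfl⟩ : ∃ k, D = k + 2 := ⟨D - 2, by omega⟩
  have hk : ((k + 2 : ℕ) : ℝ) - 1 = ((k + 1 : ℕ) : ℝ) := by push_cast; ring
  have hk0 : (0 : ℝ) < ((k + 1 : ℕ) : ℝ) := by positivity
  rw [hk]
  set δ : ℝ := ((k + 1 : ℕ) : ℝ) with hδ
  set K : ℕ := (k + 2) * (2 * v) * (6 * v) ^ (k + 1) with hK
  have hKpos : (0 : ℝ) < K := by positivity
  have hmain : ∀ L : ℕ, 0 < L → (L : ℝ) ^ (k + 1) = (L : ℝ) ^ (α / δ) * (L : ℝ) ^ (δ - α / δ) := by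
    intro L hL
    rw [← Real.rpow_add (by positivity), add_sub_cancel, hδ, Real.rpow_natCast]
  rcases le_or_gt α δ with hα | hα
  -- The bound `1` ensures `R ≤ L`; the other keeps the shells strictly below the distance.
  · set ε : ℝ := min 1 (c / (2 * K)) with hε
    have hε0 : 0 < ε := lt_min one_pos (by positivity)
    have hεK : K * ε ^ (k + 1) < c := by
      have h1 : ε ^ (k + 1) ≤ ε := pow_le_of_le_one hε0.le (min_le_left _ _) (by omega)
      have h2 : K * ε ≤ K * (c / (2 * K)) := by gcongr; exact min_le_right _ _
      have h3 : K * (c / (2 * K)) = c / 2 := by field_simp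
      have h4 : K * ε ^ (k + 1) ≤ K * ε := by gcongr
      linarith
    refine ⟨m * (2 * v + 1) * (2 * v / ε) + m * (8 * (k + 2 : ℕ) * v ^ 2) * (2 / ε),
      fun L hL bc G N s hG hs hd => ?_⟩
    obtain ⟨hb1, -, hb3⟩ := barrierMax_bounds hD hG hs hv hw hwS
    have hL1 : (1 : ℝ) ≤ L := by exact_mod_cast hL
    have hL0 : (0 : ℝ) < L := by positivity
    set X : ℝ := (L : ℝ) ^ (α / δ) with hX
    set Y : ℝ := (L : ℝ) ^ (δ - α / δ) with hY
    have hX0 : 0 < X := Real.rpow_pos_of_pos hL0 _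
    have hY0 : 0 < Y := Real.rpow_pos_of_pos hL0 _
    have hXL : X ≤ L := by
      calc X ≤ (L : ℝ) ^ (1 : ℝ) := Real.rpow_le_rpow_of_exponent_le hL1 ((div_le_one hk0).2 hα)
        _ = L := Real.rpow_one _
    have hXα : X ^ (k + 1) = (L : ℝ) ^ α := by
      rw [hX, ← Real.rpow_natCast, ← Real.rpow_mul hL0.le, ← hδ, div_mul_cancel₀ _ hk0.ne']
    set R : ℕ := ⌊ε * X⌋₊ with hR
    have hRX : (R : ℝ) ≤ ε * X := Nat.floor_le (by positivity)
    have hXR : ε * X < R + 1 := Nat.lt_floor_add_one _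
    rw [add_mul]
    rcases lt_or_ge R (2 * v) with hRv | hRv
    -- No room for walls: `X` is bounded, so the hyperplane bound `L ^ (k + 1) = X * Y` is already
    -- of order `Y`.
    · have h1 : ε * X ≤ 2 * v := by
        have : (R : ℝ) + 1 ≤ 2 * v := by exact_mod_cast hRv
        linarith
      have h2 : X ≤ 2 * v / ε := by rw [le_div_iff₀ hε0]; linarith
      calc (barrierMax G s : ℝ) ≤ m * (2 * v + 1) * (L : ℝ) ^ (k + 1) := by exact_mod_cast hb1
        _ = m * (2 * v + 1) * X * Y := by rw [hmain L hL]; ring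
        _ ≤ m * (2 * v + 1) * (2 * v / ε) * Y := by gcongr
        _ ≤ _ := le_add_of_nonneg_right (by positivity)
    · have hR1 : (1 : ℝ) ≤ R := by exact_mod_cast (show 1 ≤ R by omega)
      have hRL : R ≤ L := by
        have : (R : ℝ) ≤ L := hRX.trans ((mul_le_of_le_one_left hX0.le (min_le_left _ _)).trans hXL)
        exact_mod_cast this
      have hKR : ((K * R ^ (k + 1) : ℕ) : ℝ) < c * (L : ℝ) ^ α := by
        push_cast
        calc (K : ℝ) * (R : ℝ) ^ (k + 1) ≤ K * (ε * X) ^ (k + 1) := by gcongr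
          _ = K * ε ^ (k + 1) * (L : ℝ) ^ α := by rw [mul_pow, hXα]; ring
          _ < c * (L : ℝ) ^ α := by gcongr
      have hb := hb3 R hRv hRL (natCast_lt_distance hd hKR)
      -- Undoing the floor: `ε * X < R + 1 ≤ 2 * R`.
      have h1 : (L : ℝ) / R ≤ L * (2 / ε) / X := by
        rw [div_le_div_iff₀ (by positivity) hX0]
        have : X ≤ 2 / ε * R := by
          rw [div_mul_eq_mul_div, le_div_iff₀ hε0]
          linarith
        calc (L : ℝ) * X ≤ L * (2 / ε * R) := by gcongr
          _ = _ := by ring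
      calc (barrierMax G s : ℝ)
          ≤ m * (8 * (k + 2 : ℕ) * v ^ 2) * (L / R : ℕ) * (L : ℝ) ^ k := by exact_mod_cast hb
        _ ≤ m * (8 * (k + 2 : ℕ) * v ^ 2) * (L * (2 / ε) / X) * (L : ℝ) ^ k := by
            gcongr
            exact Nat.cast_div_le.trans h1
        _ = m * (8 * (k + 2 : ℕ) * v ^ 2) * (2 / ε) * ((L : ℝ) ^ (k + 1) / X) := by ring
        _ = m * (8 * (k + 2 : ℕ) * v ^ 2) * (2 / ε) * Y := by
            rw [hmain L hL, mul_div_cancel_left₀ _ hX0.ne']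
        _ ≤ _ := le_add_of_nonneg_left (by positivity)
  · have hα0 : 0 < α := hk0.trans hα
    have hαδ : 0 < α - δ := sub_pos.2 hα
    -- `(K / c) ^ (1 / (α - δ))` bounds every `L` for which the distance does not yet force the code
    -- to be trivial.
    refine ⟨m * (2 * v + 1) * ((K / c) ^ (1 / (α - δ))) ^ (α / δ),
      fun L hL bc G N s hG hs hd => ?_⟩
    obtain ⟨hb1, hb2, -⟩ := barrierMax_bounds hD hG hs hv hw hwS
    have hL0 : (0 : ℝ) < L := by exact_mod_cast hL
    rcases lt_or_ge ((K * L ^ (k + 1) : ℕ) : ℝ) (c * (L : ℝ) ^ α) with h | h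
    · rw [hb2 (natCast_lt_distance hd h), Nat.cast_zero]
      positivity
    · have h1 : (L : ℝ) ^ (α - δ) ≤ K / c := by
        rw [Real.rpow_sub hL0, div_le_div_iff₀ (by positivity) hc, hδ, Real.rpow_natCast]
        push_cast at h
        linarith
      have h2 : (L : ℝ) ≤ (K / c) ^ (1 / (α - δ)) := by
        calc (L : ℝ) = ((L : ℝ) ^ (α - δ)) ^ (1 / (α - δ)) := by
              rw [← Real.rpow_mul hL0.le, mul_one_div_cancel hαδ.ne', Real.rpow_one]
          _ ≤ _ := Real.rpow_le_rpow (by positivity) h1 (by positivity)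
      calc (barrierMax G s : ℝ) ≤ m * (2 * v + 1) * (L : ℝ) ^ (k + 1) := by exact_mod_cast hb1
        _ = m * (2 * v + 1) * (L : ℝ) ^ (α / δ) * (L : ℝ) ^ (δ - α / δ) := by
            rw [hmain L hL]; ring
        _ ≤ _ := by gcongr

end SubsystemCode

end

open SubsystemCode in
/-- **Limitation on partial self correction in local subsystem codes.** The constant `C` depends
only on the dimension, the interaction ranges `w` and `wS` of the gauge and stabilizer generators,
the bound `m` on the number of stabilizer generators acting on a qubit, and the constants `c` and
`α` in the lower bound on the distance; it does not depend on `L` or on the code. -/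
theorem theorem4 :
    (∀ (w wS m : ℕ) (c : ℝ), 0 < c →
      ∃ C : ℝ, ∀ (L : ℕ), 0 < L → ∀ (bc : Boundary)
        (G : Submodule (ZMod 2) (Pauli (Site 2 L))) (N : ℕ) (s : Fin N → Pauli (Site 2 L)),
        HasLocalGenerators bc w G →
        IsLocalStabilizerFamily bc wS m G s →
        ENNReal.ofReal (c * (L : ℝ)) ≤ ((distance G : ℕ∞) : ℝ≥0∞) →
        (barrierMax G s : ℝ) ≤ C) ∧
    (∀ (D : ℕ), 2 ≤ D → ∀ (w wS m : ℕ) (c α : ℝ), 0 < c →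
      ∃ C : ℝ, ∀ (L : ℕ), 0 < L → ∀ (bc : Boundary)
        (G : Submodule (ZMod 2) (Pauli (Site D L))) (N : ℕ) (s : Fin N → Pauli (Site D L)),
        HasLocalGenerators bc w G →
        IsLocalStabilizerFamily bc wS m G s →
        ENNReal.ofReal (c * (L : ℝ) ^ α) ≤ ((distance G : ℕ∞) : ℝ≥0∞) →
        (barrierMax G s : ℝ) ≤ C * (L : ℝ) ^ ((D : ℝ) - 1 - α / ((D : ℝ) - 1))) := by
  refine ⟨fun w wS m c hc => ?_, fun D hD w wS m c α hc => exists_barrierMax_le hD w wS m α hc⟩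
  obtain ⟨C, hC⟩ := exists_barrierMax_le le_rfl w wS m 1 hc
  refine ⟨C, fun L hL bc G N s hG hs hd => ?_⟩
  have h := hC L hL bc G N s hG hs (by rwa [Real.rpow_one])
  norm_num at h
  exact h
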